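/- Let $(R,\mathfrak m)$ be a Noetherian local ring of dimension $d$. A finitely generated $R$-module $M$ is a $d$th syzygy if there is an exact sequence $0\to M\to F_{d-1}\to\cdots\to F_0$ with all $F_i$ free of finite rank (for $d=0$: $M$ is any finitely generated module). Let $c_1,\dots,c_d\in\mathfrak m$ be a Koszul annihilating sequence (KAS) for the family of $d$th syzygies; that is, $c_1,\dots,c_d$ is a system of parameters of $R$, and for every $d$th syzygy $M$, every $0\le k\le d$ and all $x_1,\dots,x_k$ such that $x_1,\dots,x_k,c_{k+1},\dots,c_d$ is a system of parameters of $R$, the Koszul homology satisfies $$c_v\,H_p(x_1,\dots,x_k,c_{k+1}^s,\dots,c_j^s;M)=0\quad\text{for all } d\ge v\ge j\ge k\ge 1 \text{ and all } p,s\ge 1.$$ For a homomorphism $\partial$ of finitely generated free $R$-modules let $I_r(\partial)$ be the ideal generated by the $r\times r$ minors of a matrix representing $\partial$ (with $I_0(\partial)=R$), let $\operatorname{rank}\partial=\max\{r\mid I_r(\partial)\neq 0\}$, and let $I(\partial)=I_{\operatorname{rank}\partial}(\partial)$. Then there exists an integer $t\ge 0$ (depending only on $R$ and $c_1,\dots,c_d$)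 such that $$c_{n+j}^{\,t}\,H_i(G_\bullet\otimes_R M)=0$$ for all $n\le d$, all $i\ge 1$, all $0\le j\le d-n$ with $n+j\ge 1$, every $d$th syzygy $M$, and every complex $G_\bullet\colon 0\to G_n\xrightarrow{\partial_n}G_{n-1}\to\cdots\xrightarrow{\partial_1}G_0\to 0$ of finitely generated free $R$-modules with the following properties: 1. $G_\bullet$ satisfies the standard conditions on rank: $\operatorname{rank}G_i=\operatorname{rank}\partial_i+\operatorname{rank}\partial_{i+1}$ for $1\le i\le n$ (where $\partial_{n+1}=0$); 2. for $1\le i\le n$ the ideal $I(\partial_i)+(c_{i+1},\dots,c_d)$ is $\mathfrak m$-primary. -/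

import Mathlib

open CategoryTheory

universe u

noncomputable section

/-! ### Primary ideals and systems of parameters -/

/-- `I` is `𝔪`-primary, where `𝔪` is the maximal ideal of the local ring `R`. -/
def IsMPrimary {R : Type u} [CommRing R] [IsLocalRing R] (I : Ideal R) : Prop :=
  I.IsPrimary ∧ I.radical = IsLocalRing.maximalIdeal R

/-- `y_1, …, y_d` is a system of parameters of `R`: the number `d` of elements is the dimension
of `R` and the elements generate an `𝔪`-primary ideal. -/
def IsSystemOfParameters {R : Type u} [CommRing R] [IsLocalRing R] {d : ℕ} (y : Fin d → R) :
    Prop :=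
  ringKrullDim R = d ∧ IsMPrimary (Ideal.span (Set.range y))

/-! ### The Koszul complex -/

section Koszul

variable {R : Type u} [CommRing R] {n : ℕ} (M : Type u) [AddCommGroup M] [Module R M]

/-- The degree `p` part `⋀^p R^n ⊗ M` of the Koszul complex on `n` elements: a chain `m` stands for
`∑ e_S ⊗ m_S` over the `p`-element subsets `S` of `{1, …, n}`. -/
abbrev KoszulChain (n p : ℕ) (M : Type u) : Type u :=
  {S : Finset (Fin n) // S.card = p} → M

/-- The Koszul differential
`e_S ⊗ m ↦ ∑_{a ∈ S} (-1) ^ #{b ∈ S | b < a} e_{S \ {a}} ⊗ x_a m`, read coefficient by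
coefficient. -/
def koszulDiff (x : Fin n → R) (p : ℕ) : KoszulChain n (p + 1) M →ₗ[R] KoszulChain n p M where
  toFun m T := ∑ a : {a : Fin n // a ∉ T.1},
    ((-1 : R) ^ (T.1.filter (· < a.1)).card * x a.1) •
      m ⟨insert a.1 T.1, by rw [Finset.card_insert_of_notMem a.2, T.2]⟩
  map_add' m m' := by
    funext T
    simp [smul_add, Finset.sum_add_distrib]
  map_smul' r m := by
    funext T
    simp only [Pi.smul_apply, RingHom.id_apply, Finset.smul_sum]
    exact Finset.sum_congr rfl fun a _ => smul_comm _ _ _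

theorem koszulDiff_koszulDiff (x : Fin n → R) (p : ℕ) (m : KoszulChain n (p + 2) M) :
    koszulDiff M x p (koszulDiff M x (p + 1) m) = 0 := by
  classical
  funext T
  simp only [koszulDiff, LinearMap.coe_mk, AddHom.coe_mk, Finset.smul_sum, smul_smul,
    Pi.zero_apply]
  rw [Finset.sum_sigma']
  have key : ∀ a b : Fin n, a ≠ b → a ∉ T.1 →
      ((insert a T.1).filter (· < b)).card
        = (T.1.filter (· < b)).card + if a < b then 1 else 0 := by
    intro a b _ ha
    rw [Finset.filter_insert]
    split_ifs with h
    · rw [Finset.card_insert_of_notMem (by simp [ha])]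
    · rfl
  have hne : ∀ (a : {a : Fin n // a ∉ T.1}) (b : {b : Fin n // b ∉ insert a.1 T.1}),
      a.1 ≠ b.1 ∧ b.1 ∉ T.1 := fun a b =>
    ⟨fun h => b.2 (h ▸ Finset.mem_insert_self _ _), fun h => b.2 (Finset.mem_insert_of_mem h)⟩
  refine Finset.sum_involution
    (fun ab _ => ⟨⟨ab.2.1, (hne ab.1 ab.2).2⟩, ⟨ab.1.1, by
      simp only [Finset.mem_insert, not_or]
      exact ⟨(hne ab.1 ab.2).1, ab.1.2⟩⟩⟩) ?_ ?_ ?_ ?_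
  · rintro ⟨⟨a, ha⟩, ⟨b, hb⟩⟩ _
    obtain ⟨hab, hb'⟩ := hne ⟨a, ha⟩ ⟨b, hb⟩
    simp only at hab hb' ⊢
    have hS : insert b (insert a T.1) = insert a (insert b T.1) := Finset.insert_comm _ _ _
    simp only [hS]
    rw [← add_smul, key a b hab ha, key b a hab.symm hb']
    rcases lt_or_gt_of_ne hab with h | h
    · rw [if_pos h, if_neg h.le.not_gt]
      convert zero_smul R _ using 2
      ring
    · rw [if_neg h.le.not_gt, if_pos h]
      convert zero_smul R _ using 2
      ring
  · rintro ⟨⟨a, ha⟩, ⟨b, hb⟩⟩ _ _ h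
    have := congrArg (fun z => z.1.1) h
    exact (hne ⟨a, ha⟩ ⟨b, hb⟩).1 this.symm
  · intros
    exact Finset.mem_univ _
  · intros
    rfl

/-- The Koszul complex `K_•(x_1, …, x_n; M)`. -/
def koszulComplex (x : Fin n → R) : ChainComplex (ModuleCat.{u} R) ℕ :=
  ChainComplex.of (fun p => ModuleCat.of R (KoszulChain n p M))
    (fun p => ModuleCat.ofHom (koszulDiff M x p))
    (fun p => ModuleCat.hom_ext (LinearMap.ext (koszulDiff_koszulDiff M x p)))

end Koszul

/-! ### Syzygies and Koszul annihilating sequences -/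

/-- `M` is a `k`-th syzygy of a finitely generated module: there is an exact sequence
`0 → M → F_{k-1} → ⋯ → F_0` with all `F_i` free of finite rank (and, for `k = 0`, `M` is any
finitely generated module). -/
def IsSyzygy (R : Type u) [CommRing R] :
    ℕ → ∀ (M : Type u) [AddCommGroup M] [Module R M], Prop
  | 0, M, _, _ => Module.Finite R M
  | k + 1, M, _, _ =>
      ∃ (r : ℕ) (N : Type u) (_ : AddCommGroup N) (_ : Module R N)
        (f : M →ₗ[R] (Fin r → R)) (g : (Fin r → R) →ₗ[R] N),
        Function.Injective f ∧ Function.Exact f g ∧ Function.Surjective g ∧ IsSyzygy R k N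

/-- The sequence `x_1, …, x_k, c_{k+1}^t, …, c_j^t` of length `j` (for `k ≤ j`). Sequences are
numbered from `1`, so that the entry at position `a : Fin j` has number `a + 1`. -/
def splice {R : Type u} [CommRing R] (x c : ℕ → R) (k t j : ℕ) : Fin j → R :=
  fun a => if (a : ℕ) + 1 ≤ k then x (a + 1) else c (a + 1) ^ t

/-- `c_i, …, c_d` is a Koszul annihilating sequence for `M`, where `d` is the dimension of the
local ring `R`. Only the values `c i, …, c d` of the function `c` matter. -/
structure IsKAS {R : Type u} [CommRing R] [IsLocalRing R] (d i : ℕ) (c : ℕ → R)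
    (M : Type u) [AddCommGroup M] [Module R M] : Prop where
  mem_maximalIdeal : ∀ v, i ≤ v → v ≤ d → c v ∈ IsLocalRing.maximalIdeal R
  part_of_parameters : ∃ x : ℕ → R, IsSystemOfParameters (splice x c (i - 1) 1 d)
  annihilates : ∀ k, i ≤ k + 1 → k ≤ d → ∀ x : ℕ → R,
    IsSystemOfParameters (splice x c k 1 d) →
    ∀ v j, i ≤ v → v ≤ d → j ≤ v → k ≤ j → 1 ≤ k →
    ∀ n t, 1 ≤ n → 1 ≤ t →
    ∀ z : (koszulComplex M (splice x c k t j)).homology n, c v • z = 0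

/-! ### Complexes of free modules and the standard conditions on rank -/

section Rank

variable {R : Type u} [CommRing R] {F F' : Type u} [AddCommGroup F] [Module R F]
  [Module.Free R F] [Module.Finite R F] [AddCommGroup F'] [Module R F'] [Module.Free R F']
  [Module.Finite R F']

/-- `I_r(f)`: the ideal generated by the `r × r` minors of a matrix that represents the map `f`
of finitely generated free modules. -/
def minorsIdeal (r : ℕ) (f : F →ₗ[R] F') : Ideal R :=
  letI := Classical.decEq (Module.Free.ChooseBasisIndex R F)
  Ideal.span {a | ∃ (ρ : Fin r → Module.Free.ChooseBasisIndex R F')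
    (σ : Fin r → Module.Free.ChooseBasisIndex R F), Function.Injective ρ ∧ Function.Injective σ ∧
      a = ((LinearMap.toMatrix (Module.Free.chooseBasis R F) (Module.Free.chooseBasis R F')
        f).submatrix ρ σ).det}

/-- The rank of `f`: the largest `r` with `I_r(f) ≠ 0`. -/
def detRank (f : F →ₗ[R] F') : ℕ := sSup {r | minorsIdeal r f ≠ ⊥}

/-- `I(f) = I_{rank f}(f)`. -/
def rankIdeal (f : F →ₗ[R] F') : Ideal R := minorsIdeal (detRank f) f

end Rank

section Complexes

variable {R : Type u} [CommRing R] (G : ChainComplex (ModuleCat.{u} R) ℕ)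

/-- The differential `∂_i : G_i → G_{i-1}` (used for `i ≥ 1`) as a linear map. -/
def boundary (i : ℕ) : G.X i →ₗ[R] G.X (i - 1) := (G.d i (i - 1)).hom

/-- The complex has the form `0 → G_n → ⋯ → G_0 → 0`. -/
def HasLength (n : ℕ) : Prop := ∀ i, n < i → Subsingleton (G.X i)

/-- The standard conditions on rank for a complex of length `n`:
`rank G_i = rank ∂_i + rank ∂_{i+1}` for `1 ≤ i ≤ n`. -/
def StandardRankConditions [∀ i, Module.Free R (G.X i)] [∀ i, Module.Finite R (G.X i)] (n : ℕ) :
    Prop :=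
  ∀ i, 1 ≤ i → i ≤ n →
    Module.finrank R (G.X i) = detRank (boundary G i) + detRank (boundary G (i + 1))

/-- The complex `G_• ⊗_R M`. -/
def tensorComplex (M : Type u) [AddCommGroup M] [Module R M] : ChainComplex (ModuleCat.{u} R) ℕ :=
  ((MonoidalCategory.tensorRight (ModuleCat.of R M)).mapHomologicalComplex
    (ComplexShape.down ℕ)).obj G

end Complexes

end

/-! The proof is an induction on the length `n` of the complex. The exponent `annihilatorExponent n`
depends on `n` alone, so its value at `d` serves all `n ≤ d`. The induction runs over arbitrary
modules carrying the data of `MinorsData`, because `M` has to be replaced by localizations.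

In length `n + 1`, invert a maximal minor `δ` of the last map. That map then splits, and cancelling
the rows of the minor leaves a complex of length `n` that still satisfies the conditions on ranks
and minors (`MinorsData.removeRows`). Hence `c ^ t(n)` times the positive homology is `δ`-power
torsion (`exists_minor_pow_smul_eq`). This holds for every maximal minor, so also for `n + 1`
elements `x_a` of the ideal they generate.

The torsion is removed by a chase in the double complex of Koszul chains on powers of `x` with
coefficients in the given complex (`exists_boundary_of_koszulAnnihilated`). A cycle is placed in top
Koszul degree. Each of the `n + 1` steps costs `c ^ t(n)` for lifting along the complex and one
further `c` for killing Koszul homology, whence `t(n + 1) = (n + 1)(t(n) + 1)`.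

The sequences exist because `I(∂_k) + (c_{k+1}, …, c_d)` is primary to the maximal ideal: some `k`
elements of `I(∂_k)` complete `c_{k+1}, …, c_d` to a system of parameters (`exists_parameters_mem`),
and the KAS property yields annihilation by `c_v` for all `v ≥ k`, in particular for `v = n + j`. -/

/-! ### Matrices acting on vectors with entries in a module -/

section ModVec

variable {R : Type*} [CommRing R] {M : Type*} [AddCommGroup M] [Module R M]
  {M' : Type*} [AddCommGroup M'] [Module R M'] {κ ι ν : Type*} [Fintype ι] [Fintype ν]

/-- The map `M^ι → M^κ` given by a matrix over `R`. -/
def Matrix.modVec (A : Matrix κ ι R) (M : Type*) [AddCommGroup M] [Module R M] :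
    (ι → M) →ₗ[R] (κ → M) where
  toFun f j := ∑ k, A j k • f k
  map_add' f g := by
    funext j
    simp [smul_add, Finset.sum_add_distrib]
  map_smul' r f := by
    funext j
    simp only [Pi.smul_apply, RingHom.id_apply, Finset.smul_sum]
    exact Finset.sum_congr rfl fun a _ => smul_comm _ _ _

theorem Matrix.modVec_apply (A : Matrix κ ι R) (f : ι → M) (j : κ) :
    A.modVec M f j = ∑ k, A j k • f k := rfl

theorem Matrix.modVec_mul (A : Matrix κ ι R) (B : Matrix ι ν R) (f : ν → M) :
    (A * B).modVec M f = A.modVec M (B.modVec M f) := by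
  funext j
  simp only [Matrix.modVec_apply, Matrix.mul_apply, Finset.sum_smul, Finset.smul_sum, smul_smul]
  exact Finset.sum_comm

theorem Matrix.modVec_zero (f : ι → M) : (0 : Matrix κ ι R).modVec M f = 0 := by
  funext j
  simp [Matrix.modVec_apply]

theorem Matrix.modVec_smul_one [DecidableEq ι] (r : R) (f : ι → M) :
    (r • (1 : Matrix ι ι R)).modVec M f = r • f := by
  funext j
  simp [Matrix.modVec_apply, Matrix.one_apply]

theorem Matrix.modVec_comp (A : Matrix κ ι R) (g : M →ₗ[R] M') (f : ι → M) :
    A.modVec M' (fun k => g (f k)) = fun j => g (A.modVec M f j) := by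
  funext j
  simp [Matrix.modVec_apply]

/-- Cramer's rule: up to the factor `det`, prescribed values on the rows of a minor are attained
by a vector supported on its columns. -/
theorem Matrix.exists_modVec_eq_det_smul [DecidableEq ι] {r : ℕ} (A : Matrix κ ι R)
    (ρ : Fin r → κ) (σ : Fin r → ι) (f : κ → M) :
    ∃ w : ι → M, (∀ k, k ∉ Set.range σ → w k = 0) ∧
      ∀ b, A.modVec M w (ρ b) = (A.submatrix ρ σ).det • f (ρ b) := by
  set v := (A.submatrix ρ σ).adjugate.modVec M (f ∘ ρ) with hv
  refine ⟨fun k => ∑ a, if σ a = k then v a else 0, fun k hk => ?_, fun b => ?_⟩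
  · refine Finset.sum_eq_zero fun a _ => if_neg fun h => hk ⟨a, h⟩
  · have h1 : (A.submatrix ρ σ).modVec M v = (A.submatrix ρ σ).det • (f ∘ ρ) := by
      rw [hv, ← Matrix.modVec_mul, Matrix.mul_adjugate, Matrix.modVec_smul_one]
    have h2 := congrFun h1 b
    simp only [Pi.smul_apply, Function.comp_apply] at h2
    rw [← h2, Matrix.modVec_apply, Matrix.modVec_apply]
    simp only [Finset.smul_sum, smul_ite, smul_zero]
    rw [Finset.sum_comm]
    simp

/-- A vector supported on the columns of a minor and killed by the matrix is killed by the
minor. -/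
theorem Matrix.det_smul_eq_zero_of_modVec_eq_zero {r : ℕ} (A : Matrix κ ι R)
    (ρ : Fin r → κ) (σ : Fin r → ι) (hσ : Function.Injective σ) (f : ι → M)
    (hf : ∀ k, k ∉ Set.range σ → f k = 0) (h : A.modVec M f = 0) :
    (A.submatrix ρ σ).det • f = 0 := by
  have h1 : (A.submatrix ρ σ).modVec M (f ∘ σ) = 0 := by
    funext b
    have := congrFun h (ρ b)
    rw [Matrix.modVec_apply, Pi.zero_apply] at this
    rw [Pi.zero_apply, ← this]
    exact Fintype.sum_of_injective σ hσ _ _ (fun k hk => by rw [hf k hk, smul_zero]) fun a => rfl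
  have h2 : (A.submatrix ρ σ).det • (f ∘ σ) = 0 := by
    rw [← Matrix.modVec_smul_one, ← Matrix.adjugate_mul, Matrix.modVec_mul, h1, map_zero]
  funext k
  by_cases hk : k ∈ Set.range σ
  · obtain ⟨a, rfl⟩ := hk
    exact congrFun h2 a
  · simp [hf k hk]

end ModVec

/-! ### Koszul complexes -/

section KoszulLemmas

variable {R : Type u} [CommRing R] {m : ℕ}

theorem koszulDiff_apply (M : Type u) [AddCommGroup M] [Module R M] (x : Fin m → R) (p : ℕ)
    (y : KoszulChain m (p + 1) M) (T : {S : Finset (Fin m) // S.card = p}) :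
    koszulDiff M x p y T = ∑ a : {a : Fin m // a ∉ T.1},
      ((-1 : R) ^ (T.1.filter (· < a.1)).card * x a.1) •
        y ⟨insert a.1 T.1, by rw [Finset.card_insert_of_notMem a.2, T.2]⟩ := rfl

theorem koszulDiff_comp {M M' : Type u} [AddCommGroup M] [Module R M] [AddCommGroup M']
    [Module R M'] (x : Fin m → R) (p : ℕ) (g : M →ₗ[R] M') (y : KoszulChain m (p + 1) M) :
    koszulDiff M' x p (fun S => g (y S)) = fun T => g (koszulDiff M x p y T) := by
  funext T
  simp [koszulDiff_apply]

/-- The map `K_•(x^s; M) → K_•(x^{s+N}; M)` which is the identity in top degree. -/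
def koszulShift (M : Type u) [AddCommGroup M] [Module R M] (x : Fin m → R) (N p : ℕ) :
    KoszulChain m p M →ₗ[R] KoszulChain m p M where
  toFun y S := (∏ a ∈ S.1ᶜ, x a ^ N) • y S
  map_add' y y' := by
    funext S
    simp
  map_smul' r y := by
    funext S
    exact smul_comm _ _ _

theorem koszulShift_apply (M : Type u) [AddCommGroup M] [Module R M] (x : Fin m → R) (N p : ℕ)
    (y : KoszulChain m p M) (S : {S : Finset (Fin m) // S.card = p}) :
    koszulShift M x N p y S = (∏ a ∈ S.1ᶜ, x a ^ N) • y S := rfl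

theorem koszulShift_comp {M M' : Type u} [AddCommGroup M] [Module R M] [AddCommGroup M']
    [Module R M'] (x : Fin m → R) (N p : ℕ) (g : M →ₗ[R] M') (y : KoszulChain m p M) :
    koszulShift M' x N p (fun S => g (y S)) = fun T => g (koszulShift M x N p y T) := by
  funext T
  simp [koszulShift_apply]

theorem koszulShift_add (M : Type u) [AddCommGroup M] [Module R M] (x : Fin m → R) (N N' p : ℕ)
    (y : KoszulChain m p M) :
    koszulShift M x N' p (koszulShift M x N p y) = koszulShift M x (N + N') p y := by
  funext T
  simp only [koszulShift_apply, smul_smul, ← Finset.prod_mul_distrib, pow_add]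
  simp only [mul_comm]

/-- Passing from `T` to `insert a T` loses the factor `x_a ^ N` of the shift; the differential for
the larger exponent restores it. -/
theorem koszulDiff_koszulShift (M : Type u) [AddCommGroup M] [Module R M] (x : Fin m → R)
    (s N p : ℕ) (y : KoszulChain m (p + 1) M) :
    koszulDiff M (x ^ (s + N)) p (koszulShift M x N (p + 1) y) =
      koszulShift M x N p (koszulDiff M (x ^ s) p y) := by
  funext T
  simp only [koszulDiff_apply, koszulShift_apply, Finset.smul_sum, smul_smul, Pi.pow_apply]
  refine Finset.sum_congr rfl fun a _ => ?_
  congr 1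
  have : (T.1)ᶜ = insert a.1 (insert a.1 T.1)ᶜ := by
    ext b
    by_cases h : b = a.1
    · subst h
      simp [a.2]
    · simp [h]
  rw [this, Finset.prod_insert (by simp), pow_add]
  ring

/-- `c` annihilates the homology in positive degrees of the Koszul complexes of all powers of the
sequence `x` on `M`. -/
def KoszulAnnihilated (c : R) (x : Fin m → R) (M : Type u) [AddCommGroup M] [Module R M] : Prop :=
  ∀ s, 1 ≤ s → ∀ p, ∀ y : KoszulChain m (p + 1) M, koszulDiff M (x ^ s) p y = 0 →
    ∃ w, koszulDiff M (x ^ s) (p + 1) w = c • y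

/-- The vectors with entries in `M` whose support is contained in `T`. -/
def vectorsOn (R : Type u) [CommRing R] (M : Type u) [AddCommGroup M] [Module R M] {ι : Type u}
    (T : Finset ι) : Submodule R (ι → M) where
  carrier := {f | ∀ k ∉ T, f k = 0}
  add_mem' hf hg k hk := by simp [hf k hk, hg k hk]
  zero_mem' _ _ := rfl
  smul_mem' r f hf k hk := by simp [hf k hk]

/-- Bounding chains are found coordinate by coordinate, and taken to be zero off `T`. -/
theorem KoszulAnnihilated.vectorsOn {c : R} {x : Fin m → R} {M : Type u} [AddCommGroup M]
    [Module R M] (h : KoszulAnnihilated c x M) {ι : Type u} (T : Finset ι) :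
    KoszulAnnihilated c x (vectorsOn R M T) := by
  intro s hs p y hy
  have hex : ∀ k, ∃ w : KoszulChain m (p + 2) M, koszulDiff M (x ^ s) (p + 1) w =
      c • (fun S => (y S).1 k) ∧ (k ∉ T → w = 0) := by
    intro k
    by_cases hk : k ∈ T
    · obtain ⟨w, hw⟩ := h s hs p (fun S => (y S).1 k) (by
        have := koszulDiff_comp (x ^ s) p
          ((LinearMap.proj k : (ι → M) →ₗ[R] M) ∘ₗ (_root_.vectorsOn R M T).subtype) y
        rw [hy] at this
        exact this.trans (by funext; simp))
      exact ⟨w, hw, fun h => absurd hk h⟩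
    · refine ⟨0, ?_, fun _ => rfl⟩
      rw [map_zero]
      funext S
      simp [(y S).2 k hk]
  choose w hw hw0 using hex
  refine ⟨fun S => ⟨fun k => w k S, fun k hk => by simp [hw0 k hk]⟩, ?_⟩
  funext S
  refine Subtype.ext (funext fun k => ?_)
  have h1 := congrFun (koszulDiff_comp (x ^ s) (p + 1)
    ((LinearMap.proj k : (ι → M) →ₗ[R] M) ∘ₗ (_root_.vectorsOn R M T).subtype)
    (fun S => ⟨fun k => w k S, fun k hk => by simp [hw0 k hk]⟩)) S
  exact h1.symm.trans (congrFun (hw k) S)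

end KoszulLemmas

/-! ### The chase in the Koszul double complex -/

section Chase

variable {R : Type u} [CommRing R] {m : ℕ} (x : Fin m → R) (c : R) (t : ℕ) (B : ℕ → Type u)
  [∀ q, AddCommGroup (B q)] [∀ q, Module R (B q)] (δ : ∀ q, B (q + 1) →ₗ[R] B q)

/-- A subset `S` of size `e < m` misses some index `a`, so the weight of the shift at `S` contains
`x_a ^ N`, which turns `c ^ t` times a cycle into a boundary. There are finitely many `S`, so one
`N` suffices. -/
theorem exists_koszulShift_boundary
    (htors : ∀ q (b : B (q + 1)), δ q b = 0 → ∀ a, ∃ N, ∃ b' : B (q + 2),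
      δ (q + 1) b' = x a ^ N • c ^ t • b)
    (q e : ℕ) (he : e < m) (y : KoszulChain m e (B (q + 1))) (hy : ∀ S, δ q (y S) = 0) :
    ∃ N, ∃ y' : KoszulChain m e (B (q + 2)),
      (fun S => δ (q + 1) (y' S)) = c ^ t • koszulShift (B (q + 1)) x N e y := by
  have hex : ∀ S : {S : Finset (Fin m) // S.card = e}, ∃ a, a ∉ S.1 := by
    rintro ⟨S, rfl⟩
    by_contra! h
    rw [show S = Finset.univ from Finset.eq_univ_iff_forall.2 h] at he
    simp at he
  choose a ha using hex
  choose N b hb using fun S => htors q (y S) (hy S) (a S)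
  refine ⟨Finset.univ.sup N, fun S => ((∏ i ∈ S.1ᶜ \ {a S}, x i ^ Finset.univ.sup N) *
    x (a S) ^ (Finset.univ.sup N - N S)) • b S, ?_⟩
  funext S
  have hN : N S ≤ Finset.univ.sup N := Finset.le_sup (Finset.mem_univ S)
  rw [map_smul, hb, Pi.smul_apply, koszulShift_apply,
    ← Finset.prod_sdiff (s₁ := {a S}) (s₂ := S.1ᶜ) (by simpa using ha S), Finset.prod_singleton]
  simp only [smul_smul]
  congr 1
  conv_rhs => rw [← Nat.sub_add_cancel hN, pow_add, Nat.sub_add_cancel hN]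
  ring

/-- After a shift and multiplication by `c ^ t`, the Koszul boundary of `y` lifts along `δ` to a
chain `y'` satisfying the same hypothesis, one Koszul degree lower and one degree higher in `B`.
Shifts raise the exponent `s`, which is why annihilation is needed for all powers of `x`. -/
theorem exists_koszulShift_eq_add (hδ : ∀ q b, δ q (δ (q + 1) b) = 0)
    (hK : ∀ q, KoszulAnnihilated c x (B q)) (hB : ∀ q, m < q → Subsingleton (B q))
    (htors : ∀ q (b : B (q + 1)), δ q b = 0 → ∀ a, ∃ N, ∃ b' : B (q + 2),
      δ (q + 1) b' = x a ^ N • c ^ t • b) (e : ℕ) :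
    ∀ q s, 1 ≤ s → e < m → m ≤ q + e + 1 → ∀ y : KoszulChain m (e + 1) (B (q + 1)),
      (∀ S, δ q (koszulDiff _ (x ^ s) e y S) = 0) →
      ∃ N, ∃ w : KoszulChain m (e + 2) (B (q + 1)), ∃ u : KoszulChain m (e + 1) (B (q + 2)),
        c ^ ((e + 1) * (t + 1)) • koszulShift _ x N (e + 1) y =
          koszulDiff _ (x ^ (s + N)) (e + 1) w + fun S => δ (q + 1) (u S) := by
  induction e with
  | zero =>
    intro q s hs he hq y hy
    obtain ⟨N, y', hy'⟩ := exists_koszulShift_boundary x c t B δ htors q 0 he _ hy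
    -- Here `m ≤ q + 1`: the complex has ended, the lift `y'` is zero, and no correction is needed.
    have : Subsingleton (B (q + 2)) := hB _ (by omega)
    have h0 : koszulDiff _ (x ^ (s + N)) 0 (c ^ t • koszulShift _ x N 1 y) = 0 := by
      rw [map_smul, koszulDiff_koszulShift, ← hy']
      funext S
      simp [Subsingleton.elim (y' S) 0]
    obtain ⟨w, hw⟩ := hK (q + 1) (s + N) (by omega) 0 _ h0
    refine ⟨N, w, 0, ?_⟩
    rw [hw, smul_smul, ← pow_succ']
    simp only [zero_add, one_mul, Pi.zero_apply, map_zero]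
    exact (add_zero _).symm
  | succ e ih =>
    intro q s hs he hq y hy
    obtain ⟨N, y', hy'⟩ := exists_koszulShift_boundary x c t B δ htors q (e + 1) he _ hy
    obtain ⟨N', w', u', h'⟩ := ih (q + 1) (s + N) (by omega) (by omega) (by omega) y' (by
      intro S
      have h1 := congrFun (koszulDiff_comp (x ^ (s + N)) e (δ (q + 1)) y') S
      rw [← h1, hy', ← koszulDiff_koszulShift, map_smul, koszulDiff_koszulDiff, smul_zero]
      rfl)
    -- Subtracting `δ w'`, with `w'` obtained for the lift, turns the shifted multiple of `y` into a
    -- Koszul cycle.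
    have h0 : koszulDiff _ (x ^ (s + (N + N'))) (e + 1)
        (c ^ ((e + 1) * (t + 1) + t) • koszulShift _ x (N + N') (e + 2) y -
          fun S => δ (q + 1) (w' S)) = 0 := by
      rw [map_sub, map_smul, koszulDiff_koszulShift, koszulDiff_comp, ← koszulShift_add, pow_add,
        mul_smul, ← map_smul (koszulShift _ x N' (e + 1)), ← hy', koszulShift_comp]
      funext S
      have h2 := congrArg (δ (q + 1)) (congrFun h' S)
      simp only [Pi.add_apply, Pi.smul_apply, map_smul, map_add, hδ, add_zero] at h2
      simp only [Pi.sub_apply, Pi.smul_apply, h2, Pi.zero_apply, ← add_assoc]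
      exact sub_self _
    obtain ⟨w, hw⟩ := hK (q + 1) (s + (N + N')) (by omega) _ _ h0
    refine ⟨N + N', w, c • w', ?_⟩
    rw [hw, smul_sub, smul_smul, ← pow_succ',
      show (e + 1 + 1) * (t + 1) = (e + 1) * (t + 1) + t + 1 by ring]
    funext S
    simp

/-- If `c` annihilates the Koszul homology of the terms of a complex of length at most `m` and
`c ^ t` times its homology in positive degrees is torsion with respect to `x_1, …, x_m`, then a
power of `c` annihilates the homology in positive degrees. -/
theorem exists_boundary_of_koszulAnnihilated (hm : 0 < m) (hδ : ∀ q b, δ q (δ (q + 1) b) = 0)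
    (hK : ∀ q, KoszulAnnihilated c x (B q)) (hB : ∀ q, m < q → Subsingleton (B q))
    (htors : ∀ q (b : B (q + 1)), δ q b = 0 → ∀ a, ∃ N, ∃ b' : B (q + 2),
      δ (q + 1) b' = x a ^ N • c ^ t • b) (q : ℕ) (z : B (q + 1)) (hz : δ q z = 0) :
    ∃ u : B (q + 2), δ (q + 1) u = c ^ (m * (t + 1)) • z := by
  obtain ⟨e, rfl⟩ : ∃ e, m = e + 1 := ⟨m - 1, by omega⟩
  -- The cycle `z` sits at the only subset of full size, where the shift is the identity.
  obtain ⟨N, w, u, h⟩ := exists_koszulShift_eq_add x c t B δ hδ hK hB htors e q 1 le_rfl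
    (by omega) (by omega) (fun _ => z) (by
      intro S
      rw [← congrFun (koszulDiff_comp (x ^ 1) e (δ q) fun _ => z) S, hz]
      exact congrFun (map_zero _) S)
  refine ⟨u ⟨Finset.univ, by simp⟩, ?_⟩
  have hw : w = 0 := by
    funext S
    have := S.1.card_le_univ
    rw [S.2] at this
    simp at this
  have h1 := congrFun h ⟨Finset.univ, by simp⟩
  rw [hw, map_zero, zero_add] at h1
  rw [← h1]
  simp [koszulShift_apply]

end Chase

/-! ### Localization -/

section Localization

variable {R : Type u} [CommRing R] {M : Type u} [AddCommGroup M] [Module R M] (S : Submonoid R)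

/-- A common denominator; zero entries receive numerator `0`, so that supports do not grow. -/
theorem exists_smul_eq_mkLinearMap {X : Type*} [Finite X] (h : X → LocalizedModule S M) :
    ∃ s ∈ S, ∃ h₀ : X → M, (∀ k, h k = 0 → h₀ k = 0) ∧
      s • h = fun k => LocalizedModule.mkLinearMap S M (h₀ k) := by
  classical
  have := Fintype.ofFinite X
  obtain ⟨⟨s, hs⟩, hb⟩ := IsLocalizedModule.exist_integer_multiples S
    (LocalizedModule.mkLinearMap S M) Finset.univ h
  choose g hg using fun k => hb k (Finset.mem_univ k)
  refine ⟨s, hs, fun k => if h k = 0 then 0 else g k, fun k hk => by simp [hk], ?_⟩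
  funext k
  by_cases hk : h k = 0
  · simp [hk]
  · simp only [hk, if_false, hg]
    rfl

theorem exists_smul_eq_zero_of_mkLinearMap {X : Type*} [Finite X] (h : X → M)
    (h0 : ∀ k, LocalizedModule.mkLinearMap S M (h k) = 0) : ∃ s ∈ S, s • h = 0 := by
  classical
  have := Fintype.ofFinite X
  have hex : ∀ k, ∃ s : S, s.1 • h k = 0 := by
    intro k
    obtain ⟨s, hs⟩ := (IsLocalizedModule.eq_iff_exists S (LocalizedModule.mkLinearMap S M)).1
      ((h0 k).trans (map_zero _).symm)
    exact ⟨s, by simpa [Submonoid.smul_def] using hs⟩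
  choose s hs using hex
  refine ⟨∏ k, (s k).1, S.prod_mem fun k _ => (s k).2, ?_⟩
  funext k
  rw [Pi.smul_apply, ← Finset.prod_erase_mul _ _ (Finset.mem_univ k), mul_smul, hs, smul_zero]
  rfl

/-- `s` acts on `M` as an automorphism. -/
def ActsInvertibly (s : R) (M : Type u) [AddCommGroup M] [Module R M] : Prop :=
  Function.Bijective fun m : M => s • m

theorem actsInvertibly_one : ActsInvertibly (1 : R) M := by
  simp only [ActsInvertibly, one_smul]
  exact Function.bijective_id

theorem ActsInvertibly.mul {s s' : R} (h : ActsInvertibly s M) (h' : ActsInvertibly s' M) :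
    ActsInvertibly (s * s') M := by
  have : (fun m : M => (s * s') • m) = (fun m => s • m) ∘ fun m => s' • m := by
    funext m
    exact mul_smul _ _ _
  unfold ActsInvertibly
  rw [this]
  exact h.comp h'

theorem ActsInvertibly.pow {s : R} (h : ActsInvertibly s M) (N : ℕ) :
    ActsInvertibly (s ^ N) M := by
  induction N with
  | zero => exact pow_zero s ▸ actsInvertibly_one
  | succ N ih => exact pow_succ s N ▸ ih.mul h

theorem actsInvertibly_localizedModule {s : R} (hs : s ∈ S) :
    ActsInvertibly s (LocalizedModule S M) :=
  (Module.End.isUnit_iff _).1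
    (IsLocalizedModule.map_units (LocalizedModule.mkLinearMap S M) ⟨s, hs⟩)

/-- Lets the invertible factors in `MinorsData` accumulate under repeated localization. -/
theorem ActsInvertibly.localizedModule {s : R} (h : ActsInvertibly s M) :
    ActsInvertibly s (LocalizedModule S M) := by
  refine ⟨(injective_iff_map_eq_zero (DistribSMul.toAddMonoidHom _ s)).2 fun z hz => ?_,
    fun z => ?_⟩
  · obtain ⟨u, hu, z₀, -, hz₀⟩ := exists_smul_eq_mkLinearMap S fun _ : Unit => z
    replace hz₀ : u • z = _ := congrFun hz₀ ()
    replace hz : s • z = 0 := hz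
    obtain ⟨u', hu', h0⟩ := exists_smul_eq_zero_of_mkLinearMap S (fun _ : Unit => s • z₀ ()) (by
      intro
      rw [map_smul, ← hz₀, smul_comm, hz, smul_zero])
    replace h0 : u' • s • z₀ () = 0 := congrFun h0 ()
    rw [smul_comm] at h0
    have h1 : u' • z₀ () = 0 := h.1 (by simpa using h0)
    refine (actsInvertibly_localizedModule S (mul_mem hu' hu)).1 ?_
    simp only [mul_smul, hz₀, smul_zero]
    rw [← map_smul, h1, map_zero]
  · obtain ⟨u, hu, z₀, -, hz₀⟩ := exists_smul_eq_mkLinearMap S fun _ : Unit => z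
    replace hz₀ : u • z = _ := congrFun hz₀ ()
    obtain ⟨y, hy⟩ := h.2 (z₀ ())
    obtain ⟨w, hw⟩ := (actsInvertibly_localizedModule (M := M) S hu).2
      (LocalizedModule.mkLinearMap S M y)
    refine ⟨w, (actsInvertibly_localizedModule S hu).1 ?_⟩
    simp only at hw hy ⊢
    rw [smul_comm, hw, hz₀, ← map_smul, hy]

theorem KoszulAnnihilated.localizedModule {m : ℕ} {c : R} {x : Fin m → R}
    (h : KoszulAnnihilated c x M) : KoszulAnnihilated c x (LocalizedModule S M) := by
  intro s hs p y hy
  set l := LocalizedModule.mkLinearMap S M with hl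
  obtain ⟨u, hu, y₀, -, hy₀⟩ := exists_smul_eq_mkLinearMap S y
  obtain ⟨u', hu', h0⟩ := exists_smul_eq_zero_of_mkLinearMap S (koszulDiff M (x ^ s) p y₀) (by
    intro T
    have := congrFun (koszulDiff_comp (x ^ s) p l y₀) T
    rw [← hl, ← this, ← hy₀, map_smul, hy, smul_zero]
    rfl)
  obtain ⟨w, hw⟩ := h s hs p (u' • y₀) (by rw [map_smul, h0])
  have huu := actsInvertibly_localizedModule (M := M) S (mul_mem hu' hu)
  choose w' hw' using fun T => huu.2 (l (w T))
  replace hw' : (u' * u) • w' = fun T => l (w T) := funext hw'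
  refine ⟨w', funext fun T => huu.1 ?_⟩
  have h1 := congrArg (koszulDiff _ (x ^ s) (p + 1)) hw'
  rw [koszulDiff_comp, hw, map_smul] at h1
  refine (congrFun h1 T).trans ?_
  have h2 := congrFun hy₀ T
  simp only [Pi.smul_apply, map_smul] at h2 ⊢
  rw [← hl] at h2
  rw [← h2, mul_smul, smul_comm c u', smul_comm c u]

end Localization

/-! ### Minors -/

section Minors

variable {R : Type u} [CommRing R] {κ ι ν : Type u}

/-- The ideal generated by the `p × p` minors with rows in `T` and columns in `T'`. -/
def Matrix.minorsOn (A : Matrix κ ι R) (T : Finset κ) (T' : Finset ι) (p : ℕ) : Ideal R :=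
  Ideal.span {a | ∃ (ρ : Fin p → κ) (σ : Fin p → ι), Function.Injective ρ ∧
    Function.Injective σ ∧ (∀ b, ρ b ∈ T) ∧ (∀ b, σ b ∈ T') ∧ a = (A.submatrix ρ σ).det}

/-- With `δ` the minor, column `j` of `E` is `δ e_j - D₂ w_j`, where `w_j` comes from Cramer's rule.
The correction clears the rows of the minor and is invisible to `D` because `D D₂ = 0`. -/
theorem Matrix.exists_smul_eq_mul_of_minor [Fintype ι] [DecidableEq ι] [Fintype ν] [DecidableEq ν]
    (D : Matrix κ ι R) (D₂ : Matrix ι ν R) (hD : D * D₂ = 0) (T₁ : Finset ι) (T₂ : Finset ν)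
    (hT : ∀ k ∈ T₂, ∀ j ∉ T₁, D₂ j k = 0) {r : ℕ} (ρ : Fin r → ι) (σ : Fin r → ν)
    (hσ : ∀ b, σ b ∈ T₂) :
    ∃ E : Matrix ι ι R, (∀ j ∈ T₁, ∀ l ∉ T₁, E l j = 0) ∧ (∀ b j, E (ρ b) j = 0) ∧
      (D₂.submatrix ρ σ).det • D = D * E := by
  choose w hw hwρ using fun j => D₂.exists_modVec_eq_det_smul ρ σ (Pi.single j (1 : R))
  refine ⟨Matrix.of fun l j => (D₂.submatrix ρ σ).det • (Pi.single j (1 : R) : ι → R) l -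
    D₂.modVec R (w j) l, fun j hj l hl => ?_, fun b j => ?_, ?_⟩
  · have h1 : l ≠ j := fun h => hl (h ▸ hj)
    simp only [Matrix.of_apply, Pi.single_eq_of_ne h1, smul_zero, zero_sub, neg_eq_zero,
      Matrix.modVec_apply]
    refine Finset.sum_eq_zero fun k _ => ?_
    by_cases hk : k ∈ Set.range σ
    · obtain ⟨b, rfl⟩ := hk
      rw [hT _ (hσ b) _ hl, zero_smul]
    · rw [hw _ _ hk, smul_zero]
  · simp [hwρ]
  · ext i j
    have h1 : D.modVec R (D₂.modVec R (w j)) i = 0 := by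
      rw [← Matrix.modVec_mul, hD, Matrix.modVec_zero]
      rfl
    rw [Matrix.modVec_apply] at h1
    simp only [smul_eq_mul] at h1
    simp only [Matrix.mul_apply, Matrix.of_apply, mul_sub, Finset.sum_sub_distrib, h1, sub_zero,
      Matrix.smul_apply, smul_eq_mul]
    rw [Finset.sum_eq_single j]
    · simp [mul_comm]
    · intro l _ hl
      simp [hl]
    · simp

/-- The matrix `E` factors `δ` times a square submatrix of `D` through the columns `T₁'`. Their
number equals the size of the minor, so both factors are square and determinants can be taken. -/
theorem Matrix.det_pow_mul_mem_minorsOn [Fintype ι] [DecidableEq ι] [Fintype ν] [DecidableEq ν]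
    (D : Matrix κ ι R) (D₂ : Matrix ι ν R) (hD : D * D₂ = 0) (T : Finset κ) (T₁ T₁' : Finset ι)
    (T₂ : Finset ν) (hT : ∀ k ∈ T₂, ∀ j ∉ T₁, D₂ j k = 0) {r : ℕ} (ρ : Fin r → ι)
    (σ : Fin r → ν) (hσ : ∀ b, σ b ∈ T₂) (hT₁' : ∀ j, j ∈ T₁' ↔ j ∈ T₁ ∧ ∀ b, j ≠ ρ b) {a : R}
    (ha : a ∈ D.minorsOn T T₁ T₁'.card) :
    (D₂.submatrix ρ σ).det ^ T₁'.card * a ∈ D.minorsOn T T₁' T₁'.card := by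
  obtain ⟨E, hE, hEρ, hDE⟩ := D.exists_smul_eq_mul_of_minor D₂ hD T₁ T₂ hT ρ σ hσ
  set δ := (D₂.submatrix ρ σ).det
  refine Submodule.span_induction ?_ (by simp) (fun a b _ _ ha hb => by
    rw [mul_add]; exact add_mem ha hb) (fun s a _ ha => by
    rw [smul_eq_mul, mul_left_comm]; exact Ideal.mul_mem_left _ _ ha) ha
  rintro _ ⟨ρ', σ', hρ', -, hρT, hσT, rfl⟩
  set τ : Fin T₁'.card → ι := fun b => (T₁'.equivFin.symm b).1 with hτ
  have hτi : Function.Injective τ :=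
    Subtype.val_injective.comp T₁'.equivFin.symm.injective
  have hprod : δ • D.submatrix ρ' σ' = D.submatrix ρ' τ * E.submatrix τ σ' := by
    ext i j
    have h1 := congrFun (congrFun hDE (ρ' i)) (σ' j)
    rw [Matrix.mul_apply] at h1
    refine h1.trans ?_
    rw [Matrix.mul_apply]
    refine (Fintype.sum_of_injective τ hτi _ _ (fun l hl => ?_) fun b => rfl).symm
    have hl' : l ∉ T₁' := fun h => hl ⟨T₁'.equivFin ⟨l, h⟩, by simp [hτ]⟩
    rw [hT₁'] at hl'
    by_cases hl1 : l ∈ T₁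
    · push Not at hl'
      obtain ⟨b, rfl⟩ := hl' hl1
      rw [hEρ, mul_zero]
    · rw [hE _ (hσT j) _ hl1, mul_zero]
  have hdet := congrArg Matrix.det hprod
  rw [Matrix.det_smul, Matrix.det_mul, Fintype.card_fin] at hdet
  rw [hdet]
  exact Ideal.mul_mem_right _ _ (Ideal.subset_span
    ⟨ρ', τ, hρ', hτi, hρT, fun b => (T₁'.equivFin.symm b).2, rfl⟩)

end Minors

/-! ### Annihilators of the homology of complexes with bases -/

section BasedComplex

variable {R : Type u} [CommRing R] {ι : ℕ → Type u} [∀ q, Fintype (ι q)]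
  (D : ∀ q, Matrix (ι q) (ι (q + 1)) R) (r : ℕ → ℕ) (x : ∀ q, Fin (q + 1) → R) (c : R)

/-- The exponents `t(0) = 0`, `t(n + 1) = (n + 1) (t(n) + 1)`. -/
def annihilatorExponent : ℕ → ℕ
  | 0 => 0
  | n + 1 => (n + 1) * (annihilatorExponent n + 1)

theorem annihilatorExponent_monotone : Monotone annihilatorExponent :=
  monotone_nat_of_le_succ fun n => by
    rw [annihilatorExponent]
    nlinarith

/-- The subsets `T q` of the bases span a subcomplex of length `n` with the expected ranks such
that, over the elements acting invertibly on `M`, the entries of the sequence `x q` lie in the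
ideal of maximal minors of the `q`-th map; `c` annihilates the Koszul homology of these sequences
on `M`. -/
structure MinorsData (n : ℕ) (T : ∀ q, Finset (ι q)) (M : Type u) [AddCommGroup M]
    [Module R M] : Prop where
  eq_empty : ∀ q, n < q → T q = ∅
  closed : ∀ q, ∀ k ∈ T (q + 1), ∀ j ∉ T q, D q j k = 0
  card_top : ∀ q, q + 1 = n → (T (q + 1)).card = r q
  card_lt : ∀ q, q + 1 < n → (T (q + 1)).card = r q + r (q + 1)
  koszul : ∀ q, q < n → KoszulAnnihilated c (x q) M
  minors : ∀ q, q < n → ∀ a, ∃ s, ActsInvertibly s M ∧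
    s * x q a ∈ (D q).minorsOn (T q) (T (q + 1)) (r q)

variable {D r x c}

theorem MinorsData.modVec_mem {n : ℕ} {T : ∀ q, Finset (ι q)} {M : Type u} [AddCommGroup M]
    [Module R M] (h : MinorsData D r x c n T M) (q : ℕ) {f : ι (q + 1) → M}
    (hf : f ∈ vectorsOn R M (T (q + 1))) : (D q).modVec M f ∈ vectorsOn R M (T q) := by
  intro j hj
  refine Finset.sum_eq_zero fun k _ => ?_
  by_cases hk : k ∈ T (q + 1)
  · rw [h.closed q k hk j hj, zero_smul]
  · rw [hf k hk, smul_zero]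

variable [∀ q, DecidableEq (ι q)]

/-- The sub-bases that remain after splitting off the rows `ρ` of a minor in degree `n`. -/
def removeRows (T : ∀ q, Finset (ι q)) (n : ℕ) (ρ : Fin (r n) → ι n) (q : ℕ) : Finset (ι q) :=
  (T q).filter fun j => q ≤ n ∧ ∀ b, (⟨q, j⟩ : Σ q, ι q) ≠ ⟨n, ρ b⟩

/-- Only the map out of degree `n` loses columns. The lost ones are redundant for its minors up to a
power of `δ`, which acts invertibly on the localization. -/
theorem MinorsData.removeRows (hD : ∀ q, D q * D (q + 1) = 0) {n : ℕ} {T : ∀ q, Finset (ι q)}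
    {M : Type u} [AddCommGroup M] [Module R M] (h : MinorsData D r x c (n + 1) T M)
    (ρ : Fin (r n) → ι n) (σ : Fin (r n) → ι (n + 1)) (hρ : Function.Injective ρ)
    (hρT : ∀ b, ρ b ∈ T n) (hσT : ∀ b, σ b ∈ T (n + 1)) :
    MinorsData D r x c n (removeRows T n ρ)
      (LocalizedModule (Submonoid.powers ((D n).submatrix ρ σ).det) M) := by
  have hsub : ∀ q, _root_.removeRows T n ρ q ⊆ T q := fun q => Finset.filter_subset _ _
  have hlt : ∀ q, q < n → _root_.removeRows T n ρ q = T q := by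
    intro q hq
    refine Finset.filter_true_of_mem fun j _ => ⟨hq.le, fun b hb => ?_⟩
    exact hq.ne (congrArg Sigma.fst hb)
  have htop : ∀ j, j ∈ _root_.removeRows T n ρ n ↔ j ∈ T n ∧ ∀ b, j ≠ ρ b := by
    intro j
    simp [_root_.removeRows]
  have hcard : ∀ q, q + 1 = n → (_root_.removeRows T n ρ (q + 1)).card = r q := by
    rintro q rfl
    have h1 : _root_.removeRows T (q + 1) ρ (q + 1) = T (q + 1) \ Finset.univ.image ρ := by
      ext j
      simp [htop, eq_comm]
    rw [h1, Finset.card_sdiff_of_subset (by simpa [Finset.subset_iff] using hρT),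
      Finset.card_image_of_injective _ hρ, h.card_lt q (by omega)]
    simp
  refine ⟨fun q hq => ?_, fun q k hk j hj => ?_, hcard, fun q hq => ?_, fun q hq => ?_,
    fun q hq a => ?_⟩
  · exact Finset.filter_false_of_mem fun j _ hj => by omega
  · have hq : q + 1 ≤ n := (Finset.mem_filter.1 hk).2.1
    rw [hlt q (by omega)] at hj
    exact h.closed q k (hsub _ hk) j hj
  · rw [hlt _ hq, h.card_lt q (by omega)]
  · exact (h.koszul q (by omega)).localizedModule _
  · obtain ⟨s, hs, hm⟩ := h.minors q (by omega) a
    rcases Nat.lt_or_ge (q + 1) n with hq' | hq'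
    · exact ⟨s, hs.localizedModule _, by rwa [hlt _ hq, hlt _ hq']⟩
    · obtain rfl : n = q + 1 := by omega
      have hδ := actsInvertibly_localizedModule (M := M)
        (Submonoid.powers ((D (q + 1)).submatrix ρ σ).det) (Submonoid.mem_powers _)
      refine ⟨_, (hδ.pow (r q)).mul (hs.localizedModule _), ?_⟩
      rw [mul_assoc, hlt _ hq]
      have h1 := Matrix.det_pow_mul_mem_minorsOn (D q) (D (q + 1)) (hD q) (T q) (T (q + 1))
        (_root_.removeRows T (q + 1) ρ (q + 1)) (T (q + 2)) (h.closed (q + 1)) ρ σ hσT htop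
        (a := s * x q a)
      rw [hcard q rfl] at h1
      exact h1 hm

/-- If `c ^ t` annihilates homology for complexes of length `n`, then `c ^ t` times the homology of
a complex of length `n + 1` is torsion with respect to every maximal minor of its last map. -/
theorem exists_minor_pow_smul_eq (hD : ∀ q, D q * D (q + 1) = 0) {n t : ℕ}
    (ih : ∀ (M : Type u) [AddCommGroup M] [Module R M] (T : ∀ q, Finset (ι q)),
      MinorsData D r x c n T M → ∀ q, ∀ f ∈ vectorsOn R M (T (q + 1)), (D q).modVec M f = 0 →
        ∃ g ∈ vectorsOn R M (T (q + 2)), (D (q + 1)).modVec M g = c ^ t • f)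
    {T : ∀ q, Finset (ι q)} {M : Type u} [AddCommGroup M] [Module R M]
    (h : MinorsData D r x c (n + 1) T M)
    (ρ : Fin (r n) → ι n) (σ : Fin (r n) → ι (n + 1)) (hρ : Function.Injective ρ)
    (hσ : Function.Injective σ) (hρT : ∀ b, ρ b ∈ T n) (hσT : ∀ b, σ b ∈ T (n + 1))
    (q : ℕ) (f : ι (q + 1) → M) (hf : f ∈ vectorsOn R M (T (q + 1)))
    (hf0 : (D q).modVec M f = 0) :
    ∃ N, ∃ g ∈ vectorsOn R M (T (q + 2)),
      (D (q + 1)).modVec M g = ((D n).submatrix ρ σ).det ^ N • c ^ t • f := by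
  set δ := ((D n).submatrix ρ σ).det with hδ
  have hrange : ∀ k, k ∉ Set.range σ → k ∉ T (n + 1) := by
    intro k hk hkT
    have h1 : Finset.univ.image σ = T (n + 1) := by
      refine Finset.eq_of_subset_of_card_le (by simpa [Finset.subset_iff] using hσT) ?_
      rw [h.card_top n rfl, Finset.card_image_of_injective _ hσ, Finset.card_fin]
    rw [← h1] at hkT
    simp at hkT
    exact hk hkT
  have hsub : ∀ q, removeRows T n ρ q ⊆ T q := fun q => Finset.filter_subset _ _
  rcases Nat.lt_trichotomy q n with hq | rfl | hq
  -- Modulo a boundary, `δ f` is supported off the rows of the minor; only degree `n` needs a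
  -- correction, given by Cramer's rule.
  · obtain ⟨f₁, g₁, hf₁, hg₁, hfg⟩ : ∃ f₁ g₁, f₁ ∈ vectorsOn R M (removeRows T n ρ (q + 1)) ∧
        g₁ ∈ vectorsOn R M (T (q + 2)) ∧ δ • f = f₁ + (D (q + 1)).modVec M g₁ := by
      rcases Nat.lt_or_ge (q + 1) n with hq' | hq'
      · refine ⟨δ • f, 0, fun k hk => ?_, zero_mem _, by simp⟩
        have : k ∉ T (q + 1) := fun hk' => hk (Finset.mem_filter.2 ⟨hk', hq'.le, fun b hb =>
          hq'.ne (congrArg Sigma.fst hb)⟩)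
        simp [hf k this]
      · obtain rfl : n = q + 1 := by omega
        obtain ⟨w, hw, hwρ⟩ := (D (q + 1)).exists_modVec_eq_det_smul ρ σ f
        have hwT : w ∈ vectorsOn R M (T (q + 2)) := fun k hk => hw k fun ⟨b, hb⟩ =>
          hk (hb ▸ hσT b)
        refine ⟨δ • f - (D (q + 1)).modVec M w, w, fun k hk => ?_, hwT, by simp⟩
        by_cases hkT : k ∈ T (q + 1)
        · have : ∃ b, k = ρ b := by
            by_contra! hne
            exact hk (Finset.mem_filter.2 ⟨hkT, le_rfl, fun b hb => hne b (by simpa using hb)⟩)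
          obtain ⟨b, rfl⟩ := this
          simp [hwρ, hδ]
        · exact ((vectorsOn R M (T (q + 1))).sub_mem (Submodule.smul_mem _ _ hf)
            (h.modVec_mem _ hwT)) k hkT
    have hf₁0 : (D q).modVec M f₁ = 0 := by
      rw [eq_sub_of_add_eq hfg.symm, map_sub, map_smul, hf0, ← Matrix.modVec_mul, hD,
        Matrix.modVec_zero, smul_zero, sub_zero]
    set l := LocalizedModule.mkLinearMap (Submonoid.powers δ) M with hl
    obtain ⟨h₁, hh₁, hh⟩ := ih _ _ (h.removeRows hD ρ σ hρ hρT hσT) q (fun k => l (f₁ k))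
      (fun k hk => by simp [hf₁ k hk]) (by
        rw [Matrix.modVec_comp, hf₁0]
        funext k
        simp)
    obtain ⟨s, hs, g₀, hg₀0, hg₀⟩ := exists_smul_eq_mkLinearMap _ h₁
    obtain ⟨s', hs', h0⟩ := exists_smul_eq_zero_of_mkLinearMap (Submonoid.powers δ)
      (s • c ^ t • f₁ - (D (q + 1)).modVec M g₀) (by
        intro k
        have h1 := congrFun (congrArg ((D (q + 1)).modVec _) hg₀) k
        rw [Matrix.modVec_comp, map_smul, hh] at h1
        rw [Pi.sub_apply, map_sub, sub_eq_zero]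
        refine Eq.trans ?_ h1
        simp [hl])
    obtain ⟨N, rfl⟩ := hs
    obtain ⟨N', rfl⟩ := hs'
    have hg₀T : g₀ ∈ vectorsOn R M (T (q + 2)) := fun k hk => hg₀0 k (hh₁ k fun hk' =>
      hk (hsub _ hk'))
    refine ⟨N' + N + 1, δ ^ N' • g₀ + δ ^ (N' + N) • c ^ t • g₁,
      add_mem (Submodule.smul_mem _ _ hg₀T) (Submodule.smul_mem _ _
        (Submodule.smul_mem _ _ hg₁)), ?_⟩
    rw [smul_sub, sub_eq_zero] at h0
    rw [map_add, map_smul, map_smul, map_smul, ← h0, pow_succ, mul_smul, smul_comm δ (c ^ t) f,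
      hfg, smul_add, smul_add, pow_add, mul_smul, mul_smul]
  -- Top degree: the minor uses all the columns, so it kills every cycle.
  · refine ⟨1, 0, zero_mem _, ?_⟩
    rw [map_zero, pow_one, smul_comm, hδ, Matrix.det_smul_eq_zero_of_modVec_eq_zero (D q) ρ σ hσ f
      (fun k hk => hf k (hrange k hk)) hf0, smul_zero]
  · refine ⟨0, 0, zero_mem _, ?_⟩
    have : f = 0 := funext fun k => hf k (by simp [h.eq_empty (q + 1) (by omega)])
    simp [this]

theorem MinorsData.exists_pow_smul_eq (hD : ∀ q, D q * D (q + 1) = 0) (n : ℕ) :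
    ∀ (M : Type u) [AddCommGroup M] [Module R M] (T : ∀ q, Finset (ι q)),
      MinorsData D r x c n T M → ∀ q, ∀ f ∈ vectorsOn R M (T (q + 1)), (D q).modVec M f = 0 →
        ∃ g ∈ vectorsOn R M (T (q + 2)),
          (D (q + 1)).modVec M g = c ^ annihilatorExponent n • f := by
  induction n with
  | zero =>
    intro M _ _ T h q f hf _
    refine ⟨0, zero_mem _, ?_⟩
    have : f = 0 := funext fun k => hf k (by simp [h.eq_empty (q + 1) (by omega)])
    simp [this]
  | succ n ih =>
    intro M _ _ T h
    have htors : ∀ q, ∀ f ∈ vectorsOn R M (T (q + 1)), (D q).modVec M f = 0 → ∀ a, ∃ N,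
        ∃ g ∈ vectorsOn R M (T (q + 2)),
          (D (q + 1)).modVec M g = x n a ^ N • c ^ annihilatorExponent n • f := by
      intro q f hf hf0 a
      obtain ⟨s, hs, hm⟩ := h.minors n (Nat.lt_succ_self n) a
      -- The multipliers taking `c ^ t(n) • f` to a boundary form an ideal. Its radical contains
      -- every maximal minor, hence also `s * x n a`.
      set P : Ideal R := ((vectorsOn R M (T (q + 2))).map ((D (q + 1)).modVec M)).comap
        (LinearMap.toSpanSingleton R _ (c ^ annihilatorExponent n • f)) with hP
      have hle : (D n).minorsOn (T n) (T (n + 1)) (r n) ≤ P.radical := by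
        refine Ideal.span_le.2 ?_
        rintro _ ⟨ρ, σ, hρ, hσ, hρT, hσT, rfl⟩
        obtain ⟨N, g, hg, hgf⟩ := exists_minor_pow_smul_eq hD ih h ρ σ hρ hσ hρT hσT q f hf hf0
        exact ⟨N, g, hg, by simpa using hgf⟩
      obtain ⟨N, g, hg, hgf⟩ := hle hm
      -- The factor `s ^ N` acts bijectively, so it can be divided out entry by entry without
      -- enlarging the support.
      choose g' hg' using fun k => (hs.pow N).2 (g k)
      refine ⟨N, g', fun k hk => (hs.pow N).1 ?_, funext fun k => (hs.pow N).1 ?_⟩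
      · simp only [hg', hg k hk, smul_zero]
      · have h1 : s ^ N • g' = g := funext hg'
        have h2 := congrFun (congrArg ((D (q + 1)).modVec M) h1) k
        rw [map_smul, hgf] at h2
        simpa [mul_pow, mul_smul] using h2
    intro q f hf hf0
    obtain ⟨u, hu⟩ := exists_boundary_of_koszulAnnihilated (x n) c (annihilatorExponent n)
      (fun q => vectorsOn R M (T q))
      (fun q => ((D q).modVec M).restrict fun f hf => h.modVec_mem q hf) (Nat.succ_pos n)
      (fun q b => Subtype.ext (by
        change (D q).modVec M ((D (q + 1)).modVec M b.1) = 0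
        rw [← Matrix.modVec_mul, hD, Matrix.modVec_zero]))
      (fun q => (h.koszul n (Nat.lt_succ_self n)).vectorsOn (T q))
      (fun q hq => ⟨fun b b' => Subtype.ext (funext fun k => by
        rw [b.2 k (by simp [h.eq_empty q hq]), b'.2 k (by simp [h.eq_empty q hq])])⟩)
      (fun q b hb a => by
        obtain ⟨N, g, hg, hgf⟩ := htors q b.1 b.2 (congrArg Subtype.val hb) a
        exact ⟨N, ⟨g, hg⟩, Subtype.ext hgf⟩)
      q ⟨f, hf⟩ (Subtype.ext hf0)
    exact ⟨u.1, u.2, congrArg Subtype.val hu⟩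

end BasedComplex

/-! ### Homology and elements -/

section Homology

variable {R : Type u} [CommRing R]

theorem smul_homology_eq_zero_iff (K : ChainComplex (ModuleCat.{u} R) ℕ) (i : ℕ) (r : R) :
    (∀ z : K.homology (i + 1), r • z = 0) ↔
      ∀ y : K.X (i + 1), (K.d (i + 1) i).hom y = 0 →
        ∃ w : K.X (i + 2), (K.d (i + 2) (i + 1)).hom w = r • y := by
  set S := K.sc' (i + 2) (i + 1) i
  have e : K.homology (i + 1) ≃ₗ[R]
      (LinearMap.ker S.g.hom ⧸ LinearMap.range S.moduleCatToCycles) :=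
    (K.homologyIsoSc' (i + 2) (i + 1) i (by simp) (by simp) ≪≫
      S.moduleCatHomologyIso).toLinearEquiv
  constructor
  · intro h y hy
    have h1 := h (e.symm (Submodule.Quotient.mk ⟨y, hy⟩))
    rw [← map_smul, LinearEquiv.map_eq_zero_iff, ← Submodule.Quotient.mk_smul,
      Submodule.Quotient.mk_eq_zero] at h1
    obtain ⟨w, hw⟩ := h1
    exact ⟨w, congrArg Subtype.val hw⟩
  · intro h z
    obtain ⟨z, rfl⟩ := e.symm.surjective z
    obtain ⟨⟨y, hy⟩, rfl⟩ := Submodule.Quotient.mk_surjective _ z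
    obtain ⟨w, hw⟩ := h y hy
    rw [← map_smul, LinearEquiv.map_eq_zero_iff, ← Submodule.Quotient.mk_smul,
      Submodule.Quotient.mk_eq_zero]
    exact ⟨w, Subtype.ext hw⟩

theorem koszulComplex_d (M : Type u) [AddCommGroup M] [Module R M] {n : ℕ} (x : Fin n → R)
    (p : ℕ) : (koszulComplex M x).d (p + 1) p = ModuleCat.ofHom (koszulDiff M x p) :=
  ChainComplex.of_d (fun p => ModuleCat.of R (KoszulChain n p M))
    (fun p => ModuleCat.ofHom (koszulDiff M x p)) p

variable {F F' : Type u} [AddCommGroup F] [Module R F] [AddCommGroup F'] [Module R F']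
  {ι κ : Type u} [Fintype ι] [DecidableEq ι] [Fintype κ] [DecidableEq κ]

/-- `F ⊗ M ≃ M^ι` for a module `F` with basis indexed by `ι`. -/
noncomputable def tensorEquivFun (b : Module.Basis ι R F) (M : Type u) [AddCommGroup M]
    [Module R M] : TensorProduct R F M ≃ₗ[R] (ι → M) :=
  TensorProduct.equivFinsuppOfBasisLeft b ≪≫ₗ Finsupp.linearEquivFunOnFinite R M ι

theorem tensorEquivFun_rTensor (b : Module.Basis ι R F) (b' : Module.Basis κ R F') (M : Type u)
    [AddCommGroup M] [Module R M] (f : F →ₗ[R] F') (z : TensorProduct R F M) :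
    tensorEquivFun b' M (f.rTensor M z) =
      (LinearMap.toMatrix b b' f).modVec M (tensorEquivFun b M z) := by
  induction z using TensorProduct.induction_on with
  | zero => simp
  | add z z' h h' => simp [h, h']
  | tmul g m =>
    funext j
    have h1 := congrFun (LinearMap.toMatrix_mulVec_repr b b' f g) j
    simp [tensorEquivFun, Matrix.modVec_apply, ← h1, Matrix.mulVec, dotProduct, Finset.sum_smul,
      mul_smul]

end Homology

/-! ### Parameters -/

section Parameters

variable {R : Type u} [CommRing R] [IsLocalRing R]

/-- Modulo `c_{k+1}, …, c_d`, each `c_i` has a power congruent to some `x_i ∈ J`. Replacing `c_1, …,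
c_k` by powers of these `x_i` keeps the radical. -/
theorem exists_parameters_mem {d : ℕ} (hd : ringKrullDim R = d) (c x₀ : ℕ → R)
    (hc : IsSystemOfParameters (splice x₀ c 0 1 d)) (k : ℕ) (J : Ideal R)
    (hJ : IsMPrimary (J ⊔ Ideal.span (c '' Set.Icc (k + 1) d))) :
    ∃ x : ℕ → R, (∀ i, x i ∈ J) ∧
      ∀ s, 1 ≤ s → IsSystemOfParameters (splice (x ^ s) c k 1 d) := by
  set L := Ideal.span (c '' Set.Icc (k + 1) d) with hL
  have hcm : ∀ a : Fin d, c (a + 1) ∈ IsLocalRing.maximalIdeal R := by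
    intro a
    rw [← hc.2.2]
    exact Ideal.le_radical (Ideal.subset_span ⟨a, by simp [splice]⟩)
  have hex : ∀ i, ∃ y ∈ J, 1 ≤ i → i ≤ d → ∃ N, c i ^ N - y ∈ L := by
    intro i
    by_cases hi : 1 ≤ i ∧ i ≤ d
    · have h1 := hcm ⟨i - 1, by omega⟩
      simp only [Nat.sub_add_cancel hi.1] at h1
      rw [← hJ.2] at h1
      obtain ⟨N, hN⟩ := h1
      obtain ⟨y, hy, l, hl, hyl⟩ := Submodule.mem_sup.1 hN
      exact ⟨y, hy, fun _ _ => ⟨N, by rwa [← hyl, add_sub_cancel_left]⟩⟩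
    · exact ⟨0, zero_mem _, fun h h' => absurd ⟨h, h'⟩ hi⟩
  choose x hxJ hx using hex
  refine ⟨x, hxJ, fun s hs => ⟨hd, ?_⟩⟩
  set I := Ideal.span (Set.range (splice (x ^ s) c k 1 d)) with hI
  have hrad : I.radical = IsLocalRing.maximalIdeal R := by
    refine le_antisymm ((Ideal.IsPrime.radical_le_iff inferInstance).2 (Ideal.span_le.2 ?_)) ?_
    · rintro _ ⟨a, rfl⟩
      simp only [splice]
      split_ifs
      · have h1 : x (a + 1) ∈ IsLocalRing.maximalIdeal R := by
          rw [← hJ.2]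
          exact Ideal.le_radical (Ideal.mem_sup_left (hxJ _))
        exact Ideal.pow_mem_of_mem _ h1 s hs
      · exact Ideal.pow_mem_of_mem _ (hcm a) 1 one_pos
    · have hLI : L ≤ I := by
        refine Ideal.span_le.2 ?_
        rintro _ ⟨i, ⟨hi, hi'⟩, rfl⟩
        refine Ideal.subset_span ⟨⟨i - 1, by omega⟩, ?_⟩
        simp only [splice, Nat.sub_add_cancel (by omega : 1 ≤ i), pow_one]
        exact if_neg (by omega)
      rw [← hc.2.2, Ideal.radical_le_radical_iff]
      refine Ideal.span_le.2 ?_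
      rintro _ ⟨a, rfl⟩
      have h0 : splice x₀ c 0 1 d a = c (a + 1) := by simp [splice]
      rw [h0]
      by_cases hak : (a : ℕ) + 1 ≤ k
      · obtain ⟨N, hN⟩ := hx (a + 1) (by omega) (by omega)
        have h1 : x (a + 1) ∈ I.radical :=
          ⟨s, Ideal.subset_span ⟨a, by simp [splice, hak]⟩⟩
        have h2 : c (a + 1) ^ N ∈ I.radical := by
          have := add_mem (Ideal.le_radical (hLI hN)) h1
          rwa [sub_add_cancel] at this
        rw [SetLike.mem_coe, ← Ideal.radical_idem]
        exact ⟨N, h2⟩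
      · exact Ideal.le_radical (Ideal.subset_span ⟨a, by simp [splice, hak]⟩)
  exact ⟨Ideal.isPrimary_of_isMaximal_radical (hrad ▸ inferInstance), hrad⟩

/-- The KAS condition is used with `j = k`, where no `c` enters the sequence. The exponents `s` come
from `x ^ s` itself completing to a system of parameters. -/
theorem IsKAS.koszulAnnihilated {d : ℕ} {c : ℕ → R} {M : Type u} [AddCommGroup M] [Module R M]
    (h : IsKAS d 1 c M) {k v : ℕ} (hk : 1 ≤ k) (hkv : k ≤ v) (hvd : v ≤ d) (x : ℕ → R)
    (hx : ∀ s, 1 ≤ s → IsSystemOfParameters (splice (x ^ s) c k 1 d)) :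
    KoszulAnnihilated (c v) (fun a : Fin k => x (a + 1)) M := by
  intro s hs p y hy
  have h1 := h.annihilates k (by omega) (by omega) (x ^ s) (hx s hs) v k (by omega) hvd hkv le_rfl
    hk (p + 1) 1 (by omega) le_rfl
  have h2 : splice (x ^ s) c k 1 k = (fun a : Fin k => x (a + 1)) ^ s := by
    funext a
    simp only [splice, Pi.pow_apply]
    exact if_pos (by omega)
  rw [h2, smul_homology_eq_zero_iff] at h1
  simp only [koszulComplex_d] at h1
  exact h1 y hy

end Parameters

/-! ### The uniform annihilator -/

theorem mainTheorem7 {R : Type u} [CommRing R] [IsLocalRing R] [IsNoetherianRing R]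
    (d : ℕ) (hd : ringKrullDim R = d) (c : ℕ → R)
    (hc : ∀ (M : Type u) [AddCommGroup M] [Module R M], IsSyzygy R d M → IsKAS d 1 c M) :
    ∃ t : ℕ, ∀ (n : ℕ), n ≤ d →
      ∀ (G : ChainComplex (ModuleCat.{u} R) ℕ)
        [∀ i, Module.Free R (G.X i)] [∀ i, Module.Finite R (G.X i)],
        HasLength G n →
        StandardRankConditions G n →
        (∀ i, 1 ≤ i → i ≤ n →
          IsMPrimary (rankIdeal (boundary G i) ⊔ Ideal.span (c '' Set.Icc (i + 1) d))) →
        ∀ (M : Type u) [AddCommGroup M] [Module R M], IsSyzygy R d M →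
          ∀ i j : ℕ, 1 ≤ i → 1 ≤ n + j → n + j ≤ d →
            ∀ z : (tensorComplex G M).homology i, c (n + j) ^ t • z = 0 := by
  refine ⟨annihilatorExponent d, fun n hn G _ _ hG hrank hprim M _ _ hM i j hi hj hnj => ?_⟩
  obtain ⟨i, rfl⟩ : ∃ q, i = q + 1 := ⟨i - 1, by omega⟩
  rw [smul_homology_eq_zero_iff]
  have hKAS := hc M hM
  obtain ⟨x₀, hx₀⟩ := hKAS.part_of_parameters
  let _ : ∀ q, DecidableEq (Module.Free.ChooseBasisIndex R (G.X q)) := fun _ => Classical.decEq _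
  set b := fun q => Module.Free.chooseBasis R (G.X q)
  set D : ∀ q, Matrix (Module.Free.ChooseBasisIndex R (G.X q))
    (Module.Free.ChooseBasisIndex R (G.X (q + 1))) R :=
    fun q => LinearMap.toMatrix (b (q + 1)) (b q) (boundary G (q + 1))
  have hD : ∀ q, D q * D (q + 1) = 0 := by
    intro q
    have h1 : boundary G (q + 1) ∘ₗ boundary G (q + 2) = 0 :=
      congrArg ModuleCat.Hom.hom (G.d_comp_d (q + 2) (q + 1) q)
    exact (LinearMap.toMatrix_comp (b (q + 2)) (b (q + 1)) (b q) (boundary G (q + 1))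
      (boundary G (q + 2))).symm.trans (by rw [h1, map_zero])
  -- `D q` represents `∂_{q+1}`, hence `q + 1` entries; `q + 1 ≤ n ≤ n + j` makes `c (n + j)`
  -- available as annihilator.
  have hx : ∀ q, ∃ x : Fin (q + 1) → R, q < n → (∀ a, x a ∈ rankIdeal (boundary G (q + 1))) ∧
      KoszulAnnihilated (c (n + j)) x M := by
    intro q
    by_cases hq : q < n
    · obtain ⟨x, hx, hs⟩ := exists_parameters_mem hd c x₀ hx₀ (q + 1) _
        (hprim (q + 1) (by omega) (by omega))
      exact ⟨_, fun _ => ⟨fun a => hx _,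
        hKAS.koszulAnnihilated (by omega) (by omega) hnj x hs⟩⟩
    · exact ⟨0, fun h => absurd h hq⟩
  choose x hx using hx
  have hempty : ∀ q, n < q → IsEmpty (Module.Free.ChooseBasisIndex R (G.X q)) := by
    intro q hq
    have := hG q hq
    exact ⟨fun k => (b q).ne_zero k (Subsingleton.elim _ _)⟩
  have hdata : MinorsData D (fun q => detRank (boundary G (q + 1))) x (c (n + j)) n
      (fun q => Finset.univ) M := by
    refine ⟨fun q hq => ?_, fun q k _ j hj => absurd (Finset.mem_univ _) hj, fun q hq => ?_,
      fun q hq => ?_, fun q hq => (hx q hq).2, fun q hq a => ⟨1, ?_, ?_⟩⟩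
    · have := hempty q hq
      exact Finset.univ_eq_empty
    · have h1 := hrank (q + 1) (by omega) (by omega)
      -- `∂_{n+1}` has no columns, so it has no minors of positive size.
      have h2 : detRank (boundary G (q + 1 + 1)) = 0 := by
        have := hempty (q + 1 + 1) (by omega)
        refine Nat.eq_zero_of_le_zero (csSup_le' ?_)
        intro p hp
        by_contra hp0
        refine hp (Ideal.span_eq_bot.2 ?_)
        rintro _ ⟨_, σ, -⟩
        exact (this.false (σ ⟨0, by omega⟩)).elim
      rw [Finset.card_univ, ← Module.finrank_eq_card_chooseBasisIndex, h1, h2, add_zero]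
    · rw [Finset.card_univ, ← Module.finrank_eq_card_chooseBasisIndex]
      exact hrank (q + 1) (by omega) (by omega)
    · exact actsInvertibly_one
    · rw [one_mul]
      refine Ideal.span_mono ?_ ((hx q hq).1 a)
      rintro _ ⟨ρ, σ, hρ, hσ, rfl⟩
      exact ⟨ρ, σ, hρ, hσ, fun _ => Finset.mem_univ _, fun _ => Finset.mem_univ _, rfl⟩
  intro y hy
  obtain ⟨ε, hε⟩ : ∃ ε : ∀ q, (tensorComplex G M).X q ≃ₗ[R]
      (Module.Free.ChooseBasisIndex R (G.X q) → M), ∀ q y,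
      ε q (((tensorComplex G M).d (q + 1) q).hom y) = (D q).modVec M (ε (q + 1) y) :=
    ⟨fun q => tensorEquivFun (b q) M,
      fun q y => tensorEquivFun_rTensor (b (q + 1)) (b q) M (boundary G (q + 1)) y⟩
  obtain ⟨g, -, hg⟩ := hdata.exists_pow_smul_eq hD n M _ i (ε (i + 1) y)
    (fun k hk => absurd (Finset.mem_univ k) hk) (by rw [← hε, hy, map_zero])
  -- The extra factor `c ^ e` raises the exponent for `n` to the one for `d`.
  obtain ⟨e, he⟩ := Nat.exists_eq_add_of_le (annihilatorExponent_monotone hn)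
  refine ⟨c (n + j) ^ e • (ε (i + 2)).symm g, (ε (i + 1)).injective ?_⟩
  rw [map_smul, map_smul, hε, LinearEquiv.apply_symm_apply, hg, smul_smul, ← pow_add, he,
    add_comm e, map_smul]
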